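/- Let $b \ge 2$ be an integer and $\xi$ an irrational real number. Let $\mu \in [2, +\infty]$ denote the irrationality exponent of $\xi$, that is, the supremum of the real numbers $t$ such that the inequality $|\xi - p/q| < 1/q^{t}$ has infinitely many solutions in rational numbers $p/q$ (in lowest terms, $q \ge 1$). Let $(a_j)_{j \ge 1}$ be the $b$-ary expansion of $\xi$, that is, the sequence of digits $a_j \in \{0, 1, \ldots, b-1\}$ with $\xi = \lfloor \xi \rfloor + \sum_{j \ge 1} a_j / b^{j}$, and for $n \ge 1$ let $$p(n, \xi, b) = \mathrm{Card}\,\{ a_{j+1} a_{j+2} \ldots a_{j+n} : j \ge 0 \}$$ be the number of distinct blocks of length $n$ in this expansion. Then $$\liminf_{n \to +\infty} \frac{p(n, \xi, b)}{n} \ \ge\ 1 + \frac{-\mu^3 + 2\mu^2 + \mu - 1}{\mu^4 - 2\mu^3 + 3\mu^2 - 3\mu + 1}$$ and $$\limsup_{n \to +\infty} \frac{p(n, \xi, b)}{n} \ \ge\ \frac{\mu + \sqrt{4(\mu-1)^3 + \mu^2}}{2\mu(\mu - 1)},$$ where the lower and upper limits are taken in $[0, +\infty]$ and where, if $\mu =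 +\infty$, the two right-hand sides are read as their limits $1$ and $0$. In particular, every irrational real number $\xi$ whose irrationality exponent is equal to $2$ satisfies $$\liminf_{n \to +\infty} \frac{p(n, \xi, b)}{n} \ge \frac{8}{7} \quad \text{and} \quad \limsup_{n \to +\infty} \frac{p(n, \xi, b)}{n} \ge \frac{1 + \sqrt{2}}{2}.$$ -/

import Mathlib

open Filter

/-- The irrationality exponent of a real number `ξ`: the supremum, in the extended reals, of the
real numbers `t` such that `|ξ - p/q| < 1 / q ^ t` has infinitely many solutions in rational
numbers `p/q` (written in lowest terms, with `q > 0`). -/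
noncomputable def irrationalityExponent (ξ : ℝ) : EReal :=
  sSup ((fun t : ℝ => (t : EReal)) ''
    {t : ℝ | {r : ℚ | |ξ - (r : ℝ)| < 1 / (r.den : ℝ) ^ t}.Infinite})

/-- The subword complexity `p(n, x)` of an infinite word `x` over a finite alphabet: the number of
distinct blocks `x j, x (j + 1), …, x (j + n - 1)` of length `n`, with `j ≥ 0`. Letters are indexed
from `0`. -/
noncomputable def subwordComplexity {A : Type*} [Finite A] (x : ℕ → A) (n : ℕ) : ℕ :=
  (Set.range fun j : ℕ => fun i : Fin n => x (j + (i : ℕ))).ncard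

/-- The `b`-ary expansion of a real number `ξ`, that is, the sequence of the `b`-ary digits of its
fractional part; the entry with index `j` is the coefficient of `1 / b ^ (j + 1)`. -/
noncomputable def baryExpansion (b : ℕ) [NeZero b] (ξ : ℝ) : ℕ → Fin b :=
  Real.digits (Int.fract ξ) b

/-- The digits do expand `ξ`: `ξ = ⌊ξ⌋ + ∑_{j ≥ 0} a_j / b ^ (j + 1)`. -/
theorem hasSum_baryExpansion (b : ℕ) [NeZero b] (hb : 2 ≤ b) (ξ : ℝ) :
    HasSum (fun j : ℕ => ((baryExpansion b ξ j : ℕ) : ℝ) / (b : ℝ) ^ (j + 1)) (ξ - ⌊ξ⌋) := by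
  have h := Real.hasSum_ofDigitsTerm_digits (Int.fract ξ) (b := b) (by omega)
    ⟨Int.fract_nonneg ξ, Int.fract_lt_one ξ⟩
  exact h

/-- `p(n, ξ, b)`: the number of distinct blocks of length `n` in the `b`-ary expansion of `ξ`. -/
noncomputable def digitComplexity (n : ℕ) (ξ : ℝ) (b : ℕ) [NeZero b] : ℕ :=
  subwordComplexity (baryExpansion b ξ) n

/-! Put `ν = μ - 1` and `P = p(k)`. A block of length `n` at positions `i < j` puts `ξ` within `1 /
(b^n (b^j - b^i))` of a fraction with denominator `b^j - b^i`. Hence, for each `w > ν`, repetitions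
obey `n ≤ w j + N` (`exists_repetitionBound`). The rest is combinatorics of words under this bound.

If `p(k+1) ≥ p(k) + 2`, the complexity grows fast enough at `k`. Otherwise there is a unique right
special block of length `k`, with two continuations, and the blocks that recur form two cycles of
lengths `p`, `q` sharing a path of `h` edges. With `f` initial blocks that never recur, counting
gives `f + p + q ≤ P + h + 1` and `f + k + 1 ≤ P` (`Aperiodic.exists_startedReturnPair`). Following
the word from `f` through its first returns produces long repetitions in every case. Bounding them
and eliminating `f, g, h, p, q` leaves `Y k ≤ P + O(1)`, where `Y = (2ν² + 2ν + 1) / (ν (ν + 1)²)`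
(`RepetitionBound.le_of_succ_le`). As `Y ≤ 2`, induction yields `p(n) ≥ Y n - O(1)` for all `n`.

So the lower limit is at least `max(1, Y)`, the `1` coming from `p(n) ≥ n + 1`. Both right-hand
sides are at most `Y` when `ν³ < ν + 1` and at most `1` otherwise; the upper limit needs no argument
of its own. -/

/-! ### Coinciding blocks -/

/-- The blocks of length `n` of the word `x` starting at positions `i` and `j` coincide. -/
def Agree {A : Type*} (x : ℕ → A) (n i j : ℕ) : Prop := ∀ t < n, x (i + t) = x (j + t)

namespace Agree

variable {A : Type*} {x : ℕ → A} {m n i j l d : ℕ}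

theorem refl (x : ℕ → A) (n i : ℕ) : Agree x n i i := fun _ _ => rfl

theorem symm (h : Agree x n i j) : Agree x n j i := fun t ht => (h t ht).symm

theorem trans (h : Agree x n i j) (h' : Agree x n j l) : Agree x n i l :=
  fun t ht => (h t ht).trans (h' t ht)

theorem mono (h : Agree x n i j) (hmn : m ≤ n) : Agree x m i j :=
  fun t ht => h t (ht.trans_le hmn)

theorem shift (h : Agree x n i j) (d : ℕ) (hd : m + d ≤ n) : Agree x m (i + d) (j + d) := by
  intro t ht
  have := h (d + t) (by omega)
  rwa [← add_assoc, ← add_assoc] at this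

theorem glue (h : Agree x m i j) (d : ℕ) (h' : Agree x n (i + d) (j + d)) (hd : d ≤ m) :
    Agree x (n + d) i j := by
  intro t ht
  rcases lt_or_ge t d with h1 | h1
  · exact h t (by omega)
  · have := h' (t - d) (by omega)
    rwa [show i + d + (t - d) = i + t by omega, show j + d + (t - d) = j + t by omega] at this

theorem succ (h : Agree x n i j) (h' : x (i + n) = x (j + n)) : Agree x (n + 1) i j := by
  intro t ht
  rcases Nat.lt_succ_iff_lt_or_eq.mp ht with h1 | rfl
  · exact h t h1
  · exact h'

/-- If the block at `i` has period `d`, so has every block that agrees with it. -/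
theorem period (hp : Agree x m i (i + d)) (h : Agree x n i j) (hm : m + d ≤ n) :
    Agree x m j (j + d) := by
  intro t ht
  have h1 := h t (by omega)
  have h2 := h (d + t) (by omega)
  rw [← add_assoc, ← add_assoc] at h2
  rw [← h1, ← h2]
  exact hp t ht

end Agree

/-- No two distinct tails of `x` coincide, that is, `x` is not eventually periodic. -/
def Aperiodic {A : Type*} (x : ℕ → A) : Prop := ∀ i j, i < j → ∃ n, ¬ Agree x n i j

/-! ### Growth of the complexity of an aperiodic word -/

section Complexity

variable {A : Type*} {x : ℕ → A}

theorem word_eq_iff {n i j : ℕ} :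
    ((fun t : Fin n => x (i + (t : ℕ))) = fun t : Fin n => x (j + (t : ℕ))) ↔ Agree x n i j :=
  ⟨fun h t ht => congrFun h ⟨t, ht⟩, fun h => funext fun t => h t t.2⟩

theorem Aperiodic.shift (hx : Aperiodic x) (f : ℕ) : Aperiodic fun t => x (f + t) := by
  intro i j hij
  obtain ⟨n, hn⟩ := hx (f + i) (f + j) (by omega)
  exact ⟨n, fun h => hn fun t ht => by simpa [add_assoc] using h t ht⟩

variable [Finite A]

/-- By pigeonhole some block of length `k` recurs beyond `m`. If equal blocks there always had the
same next letter, the coincidence would propagate forever and two tails would agree. -/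
theorem Aperiodic.exists_branching (hx : Aperiodic x) (k m : ℕ) :
    ∃ i j, m ≤ i ∧ m ≤ j ∧ Agree x k i j ∧ x (i + k) ≠ x (j + k) := by
  by_contra! H
  obtain ⟨i', j', hne, he⟩ := Finite.exists_ne_map_eq_of_infinite
    (fun (j : ℕ) => fun t : Fin k => x (m + j + (t : ℕ)))
  rw [word_eq_iff] at he
  obtain ⟨i, j, hij, hmi, he⟩ : ∃ i j, i < j ∧ m ≤ i ∧ Agree x k i j := by
    rcases lt_or_gt_of_ne hne with h | h
    · exact ⟨m + i', m + j', by omega, by omega, he⟩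
    · exact ⟨m + j', m + i', by omega, by omega, he.symm⟩
  obtain ⟨n, hn⟩ := hx i j hij
  have key : ∀ n, Agree x (k + n) i j := by
    intro n
    induction n with
    | zero => exact he
    | succ n ih =>
      have h1 := H (i + n) (j + n) (by omega) (by omega) (ih.shift n le_rfl)
      refine Agree.succ ih ?_
      change x (i + (k + n)) = x (j + (k + n))
      rwa [show i + (k + n) = i + n + k by ring, show j + (k + n) = j + n + k by ring]
  exact hn ((key n).mono (by omega))

theorem card_le_subwordComplexity {n : ℕ} (S : Finset ℕ)
    (hS : ∀ i ∈ S, ∀ j ∈ S, Agree x n i j → i = j) : S.card ≤ subwordComplexity x n := by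
  have hinj : Set.InjOn (fun j : ℕ => fun t : Fin n => x (j + (t : ℕ))) (S : Set ℕ) :=
    fun i hi j hj h => hS i hi j hj (word_eq_iff.mp h)
  rw [← Set.ncard_coe_finset, ← hinj.ncard_image]
  exact Set.ncard_le_ncard (Set.image_subset_range _ _) (Set.toFinite _)

/-- Two of the blocks of length `n + 1` are redundant: after deleting those at `j` and `j'`, every
block of length `n` still has an extension, supplied by `i` and `i'` for the two affected prefixes.
This covers both two right special blocks and a single one with three continuations. -/
theorem subwordComplexity_add_two_le {n i j i' j' : ℕ} (hjj' : ¬ Agree x (n + 1) j j')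
    (hij : Agree x n i j) (hij1 : ¬ Agree x (n + 1) i j) (hij2 : ¬ Agree x (n + 1) i j')
    (hij' : Agree x n i' j') (hij1' : ¬ Agree x (n + 1) i' j') (hij2' : ¬ Agree x (n + 1) i' j) :
    subwordComplexity x n + 2 ≤ subwordComplexity x (n + 1) := by
  set W : ℕ → (Fin (n + 1) → A) := fun j t => x (j + (t : ℕ)) with hW
  have hWeq : ∀ p q, W p = W q ↔ Agree x (n + 1) p q := fun p q => word_eq_iff
  have h1 : (Set.range fun j : ℕ => fun t : Fin n => x (j + (t : ℕ))) ⊆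
      (fun w : Fin (n + 1) → A => fun t : Fin n => w t.castSucc) '' (Set.range W \ {W j, W j'}) := by
    rintro _ ⟨p, rfl⟩
    have key : ∃ q, Agree x n q p ∧ W q ≠ W j ∧ W q ≠ W j' := by
      by_cases h : W p = W j
      · exact ⟨i, hij.trans (((hWeq _ _).mp h).symm.mono (by omega)), by rwa [Ne, hWeq],
          by rwa [Ne, hWeq]⟩
      · by_cases h' : W p = W j'
        · exact ⟨i', hij'.trans (((hWeq _ _).mp h').symm.mono (by omega)), by rwa [Ne, hWeq],
            by rwa [Ne, hWeq]⟩
        · exact ⟨p, Agree.refl x n p, h, h'⟩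
    obtain ⟨q, hq, h1, h2⟩ := key
    refine ⟨W q, ⟨⟨q, rfl⟩, by simp [h1, h2]⟩, ?_⟩
    exact word_eq_iff.mpr hq
  have h2 := (Set.ncard_le_ncard h1 (Set.toFinite _)).trans (Set.ncard_image_le (Set.toFinite _))
  have h3 : ({W j, W j'} : Set (Fin (n + 1) → A)).ncard = 2 :=
    Set.ncard_pair (by rwa [Ne, hWeq])
  have h4 : ({W j, W j'} : Set (Fin (n + 1) → A)) ⊆ Set.range W := by
    rintro _ (rfl | rfl) <;> exact ⟨_, rfl⟩
  have h5 := Set.ncard_sdiff_add_ncard_of_subset h4 (Set.toFinite _)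
  rw [h3] at h5
  unfold subwordComplexity
  change _ + 2 ≤ (Set.range W).ncard
  omega

theorem Aperiodic.subwordComplexity_lt_succ (hx : Aperiodic x) (n : ℕ) :
    subwordComplexity x n < subwordComplexity x (n + 1) := by
  obtain ⟨i, j, -, -, hij, hne⟩ := hx.exists_branching n 0
  set W : ℕ → (Fin (n + 1) → A) := fun j t => x (j + (t : ℕ)) with hW
  have hWeq : ∀ p q, W p = W q ↔ Agree x (n + 1) p q := fun p q => word_eq_iff
  have hne' : W i ≠ W j := fun h => hne ((hWeq _ _).mp h n (by omega))
  have h1 : (Set.range fun j : ℕ => fun t : Fin n => x (j + (t : ℕ))) ⊆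
      (fun w : Fin (n + 1) → A => fun t : Fin n => w t.castSucc) '' (Set.range W \ {W j}) := by
    rintro _ ⟨p, rfl⟩
    by_cases h : W p = W j
    · refine ⟨W i, ⟨⟨i, rfl⟩, hne'⟩, ?_⟩
      exact word_eq_iff.mpr (hij.trans (((hWeq _ _).mp h).symm.mono (by omega)))
    · exact ⟨W p, ⟨⟨p, rfl⟩, h⟩, rfl⟩
  have h2 := (Set.ncard_le_ncard h1 (Set.toFinite _)).trans (Set.ncard_image_le (Set.toFinite _))
  have h5 := Set.ncard_sdiff_singleton_add_one (s := Set.range W) (a := W j) ⟨j, rfl⟩ (Set.toFinite _)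
  unfold subwordComplexity
  change _ < (Set.range W).ncard
  omega

theorem Aperiodic.succ_le_subwordComplexity (hx : Aperiodic x) (n : ℕ) :
    n + 1 ≤ subwordComplexity x n := by
  induction n with
  | zero =>
    refine card_le_subwordComplexity (x := x) (n := 0) {0} ?_
    simp
  | succ n ih => exact (Nat.succ_le_succ ih).trans (hx.subwordComplexity_lt_succ n)

/-- If the first `f` blocks of length `n` never occur again, they add to the complexity of the
remaining word. -/
theorem Aperiodic.add_succ_le_subwordComplexity (hx : Aperiodic x) {f n : ℕ}
    (hf : ∀ i < f, ∀ j, i < j → ¬ Agree x n i j) : f + n + 1 ≤ subwordComplexity x n := by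
  set W : ℕ → (Fin n → A) := fun j t => x (j + (t : ℕ)) with hW
  have hWeq : ∀ p q, W p = W q ↔ Agree x n p q := fun p q => word_eq_iff
  have h1 := (hx.shift f).succ_le_subwordComplexity n
  have h2 : (W '' (Finset.range f : Set ℕ)).ncard = f := by
    rw [Set.InjOn.ncard_image, Set.ncard_coe_finset, Finset.card_range]
    intro i hi j hj h
    rw [hWeq] at h
    simp only [Finset.coe_range, Set.mem_Iio] at hi hj
    by_contra hne
    rcases lt_or_gt_of_ne hne with h' | h'
    · exact hf i hi j h' h
    · exact hf j hj i h' h.symm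
  have h3 : Disjoint (W '' (Finset.range f : Set ℕ))
      (Set.range fun j : ℕ => fun t : Fin n => x (f + (j + (t : ℕ)))) := by
    rw [Set.disjoint_left]
    rintro _ ⟨i, hi, rfl⟩ ⟨j, hj⟩
    simp only [Finset.coe_range, Set.mem_Iio] at hi
    refine hf i hi (f + j) (by omega) ((hWeq _ _).mp ?_)
    rw [← hj]
    ext t
    simp [hW, add_assoc]
  have h4 := Set.ncard_union_eq h3 (Set.toFinite _) (Set.toFinite _)
  have h5 : (W '' (Finset.range f : Set ℕ)) ∪
      (Set.range fun j : ℕ => fun t : Fin n => x (f + (j + (t : ℕ)))) ⊆ Set.range W := by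
    rintro _ (⟨i, -, rfl⟩ | ⟨j, rfl⟩)
    · exact ⟨i, rfl⟩
    · exact ⟨f + j, by ext t; simp [hW, add_assoc]⟩
  have h6 := Set.ncard_le_ncard h5 (Set.toFinite _)
  unfold subwordComplexity at h1 ⊢
  change n + 1 ≤ (Set.range fun j : ℕ => fun t : Fin n => x (f + (j + (t : ℕ)))).ncard at h1
  change _ ≤ (Set.range W).ncard
  omega

end Complexity

/-! ### The unique right special block and its returns -/

/-- The set `T` of the occurrences of the unique right special block of length `k` of `x`, which is
followed by one of the two letters `a`, `b`, each of them infinitely often. -/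
structure UniqueBranching {A : Type*} (x : ℕ → A) (k : ℕ) (T : ℕ → Prop) (a b : A) : Prop where
  ne : a ≠ b
  congr : ∀ {i j}, Agree x k i j → T i → T j
  agree : ∀ {i j}, T i → T j → Agree x k i j
  det : ∀ {i j}, Agree x k i j → ¬ T i → x (i + k) = x (j + k)
  letters : ∀ {i}, T i → x (i + k) = a ∨ x (i + k) = b
  infinite_left : ∀ m, ∃ i, m ≤ i ∧ T i ∧ x (i + k) = a
  infinite_right : ∀ m, ∃ i, m ≤ i ∧ T i ∧ x (i + k) = b

theorem Aperiodic.exists_uniqueBranching {A : Type*} [Finite A] {x : ℕ → A} (hx : Aperiodic x)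
    {k : ℕ} (hk : subwordComplexity x (k + 1) ≤ subwordComplexity x k + 1) :
    ∃ (T : ℕ → Prop) (a b : A), UniqueBranching x k T a b := by
  obtain ⟨i₀, j₀, -, -, h₀, hne⟩ := hx.exists_branching k 0
  have last : ∀ {i j}, x (i + k) ≠ x (j + k) → ¬ Agree x (k + 1) i j :=
    fun h h' => h (h' k (by omega))
  have hdet : ∀ {i j}, Agree x k i j → ¬ Agree x k i i₀ → x (i + k) = x (j + k) := by
    intro i j hij hi
    by_contra hne'
    have := subwordComplexity_add_two_le (x := x) (n := k) (i := i₀) (j := j₀) (i' := i) (j' := j)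
      (fun h => hi (hij.trans ((h.mono (by omega)).symm.trans h₀.symm))) h₀ (last hne)
      (fun h => hi (hij.trans (h.mono (by omega)).symm)) hij (last hne')
      (fun h => hi ((h.mono (by omega)).trans h₀.symm))
    omega
  have hlet : ∀ {i}, Agree x k i i₀ → x (i + k) = x (i₀ + k) ∨ x (i + k) = x (j₀ + k) := by
    intro i hi
    by_contra! hc
    have := subwordComplexity_add_two_le (x := x) (n := k) (i := i₀) (j := j₀) (i' := i₀) (j' := i)
      (last hc.2.symm) h₀ (last hne) (last hc.1.symm) hi.symm (last hc.1.symm) (last hne)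
    omega
  -- Branching occurs arbitrarily far out, and only at the special block, so both continuations
  -- occur infinitely often.
  have hinf : ∀ m, ∃ i j, m ≤ i ∧ m ≤ j ∧ Agree x k i i₀ ∧ Agree x k j i₀ ∧
      x (i + k) = x (i₀ + k) ∧ x (j + k) = x (j₀ + k) := by
    intro m
    obtain ⟨i, j, hi, hj, hij, hne'⟩ := hx.exists_branching k m
    have hi₀ : Agree x k i i₀ := by
      by_contra h
      exact hne' (hdet hij h)
    have hj₀ := hij.symm.trans hi₀
    rcases hlet hi₀ with h1 | h1 <;> rcases hlet hj₀ with h2 | h2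
    · exact absurd (h1.trans h2.symm) hne'
    · exact ⟨i, j, hi, hj, hi₀, hj₀, h1, h2⟩
    · exact ⟨j, i, hj, hi, hj₀, hi₀, h2, h1⟩
    · exact absurd (h1.trans h2.symm) hne'
  refine ⟨fun i => Agree x k i i₀, x (i₀ + k), x (j₀ + k), hne, fun h h' => h.symm.trans h',
    fun h h' => h.trans h'.symm, hdet, hlet, fun m => ?_, fun m => ?_⟩
  · obtain ⟨i, j, hi, hj, hi₀, hj₀, h1, h2⟩ := hinf m
    exact ⟨i, hi, hi₀, h1⟩
  · obtain ⟨i, j, hi, hj, hi₀, hj₀, h1, h2⟩ := hinf m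
    exact ⟨j, hj, hj₀, h2⟩

/-- The first element of `T` after `t ∈ T` is `t + l`. -/
structure IsReturn (T : ℕ → Prop) (t l : ℕ) : Prop where
  pos : 0 < l
  left : T t
  right : T (t + l)
  gap : ∀ d, 0 < d → d < l → ¬ T (t + d)

namespace UniqueBranching

variable {A : Type*} {x : ℕ → A} {k : ℕ} {T : ℕ → Prop} {a b : A}

theorem symm (H : UniqueBranching x k T a b) : UniqueBranching x k T b a :=
  ⟨H.ne.symm, H.congr, H.agree, H.det, fun h => (H.letters h).symm, H.infinite_right,
    H.infinite_left⟩

/-- Away from `T` the next letter is forced, so a coincidence lasts until `T` is met. -/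
theorem extend (H : UniqueBranching x k T a b) {i j : ℕ} (hij : Agree x k i j) (d : ℕ)
    (hd : ∀ e < d, ¬ T (i + e)) : Agree x (k + d) i j := by
  induction d with
  | zero => exact hij
  | succ d ih =>
    have h1 := ih fun e he => hd e (by omega)
    have h2 := H.det (h1.shift d le_rfl) (hd d (by omega))
    refine h1.succ ?_
    rwa [show i + (k + d) = i + d + k by ring, show j + (k + d) = j + d + k by ring]

theorem mem_iff (H : UniqueBranching x k T a b) {i j d : ℕ} (hij : Agree x (k + d) i j) {e : ℕ}
    (he : e ≤ d) : T (i + e) ↔ T (j + e) :=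
  ⟨H.congr (hij.shift e (by omega)), H.congr (hij.shift e (by omega)).symm⟩

theorem exists_isReturn (H : UniqueBranching x k T a b) {t : ℕ} (ht : T t) :
    ∃ l, IsReturn T t l := by
  classical
  have hex : ∃ l, 0 < l ∧ T (t + l) := by
    obtain ⟨i, hi, hT, -⟩ := H.infinite_left (t + 1)
    exact ⟨i - t, by omega, by rwa [show t + (i - t) = i by omega]⟩
  exact ⟨Nat.find hex, (Nat.find_spec hex).1, ht, (Nat.find_spec hex).2,
    fun d h0 hd hT => Nat.find_min hex hd ⟨h0, hT⟩⟩

/-- The letter after the special block decides the whole path up to the next occurrence; hence there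
are only two return lengths. -/
theorem agree_of_isReturn (H : UniqueBranching x k T a b) {t t' l : ℕ} (hl : IsReturn T t l)
    (ht' : T t') (hx : x (t + k) = x (t' + k)) : Agree x (k + l) t t' := by
  have h1 := (H.agree hl.left ht').succ hx
  have h2 := H.extend (h1.shift (m := k) 1 le_rfl) (l - 1) fun e he => by
    rw [show t + 1 + e = t + (e + 1) by ring]
    exact hl.gap _ (by omega) (by have := hl.pos; omega)
  have h3 := h1.glue 1 h2 (by omega)
  have := hl.pos
  rwa [show k + (l - 1) + 1 = k + l by omega] at h3

theorem isReturn_of_isReturn (H : UniqueBranching x k T a b) {t t' l : ℕ} (hl : IsReturn T t l)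
    (ht' : T t') (hx : x (t + k) = x (t' + k)) : IsReturn T t' l := by
  have h := H.agree_of_isReturn hl ht' hx
  exact ⟨hl.pos, ht', (H.mem_iff h le_rfl).mp hl.right,
    fun d h0 hd hT => hl.gap d h0 hd ((H.mem_iff h hd.le).mpr hT)⟩

end UniqueBranching

/-! ### Counting blocks on the two returns -/

/-- Occurrences `r`, `s` of the right special block followed by `a` and `b`, the lengths `p`, `q` of
the corresponding returns, and the length `h` of the longest common left extension of the ends of
these returns. -/
structure ReturnPair {A : Type*} (x : ℕ → A) (k : ℕ) (T : ℕ → Prop) (a b : A) (r s p q h : ℕ) :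
    Prop extends UniqueBranching x k T a b where
  left : IsReturn T r p
  right : IsReturn T s q
  letter_left : x (r + k) = a
  letter_right : x (s + k) = b
  lt_left : h < p
  lt_right : h < q
  agree_ends : Agree x (k + h) (r + p - h) (s + q - h)
  not_agree : ∀ d, h < d → d < p → d < q → ¬ Agree x (k + d) (r + p - d) (s + q - d)

theorem UniqueBranching.exists_returnPair {A : Type*} {x : ℕ → A} {k : ℕ} {T : ℕ → Prop} {a b : A}
    (H : UniqueBranching x k T a b) (m : ℕ) :
    ∃ r s p q h, m ≤ r ∧ m ≤ s ∧ ReturnPair x k T a b r s p q h := by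
  classical
  obtain ⟨r, hr, hrT, hra⟩ := H.infinite_left m
  obtain ⟨s, hs, hsT, hsb⟩ := H.infinite_right m
  obtain ⟨p, hp⟩ := H.exists_isReturn hrT
  obtain ⟨q, hq⟩ := H.exists_isReturn hsT
  have hp0 := hp.pos
  have hq0 := hq.pos
  let P : ℕ → Prop := fun d => d < p ∧ d < q ∧ Agree x (k + d) (r + p - d) (s + q - d)
  have h0 : P 0 := ⟨hp0, hq0, H.agree hp.right hq.right⟩
  have hspec : P (Nat.findGreatest P p) := Nat.findGreatest_spec (Nat.zero_le _) h0
  exact ⟨r, s, p, q, Nat.findGreatest P p, hr, hs, H, hp, hq, hra, hsb, hspec.1, hspec.2.1,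
    hspec.2.2, fun d hd hdp hdq hA => Nat.findGreatest_is_greatest hd hdp.le ⟨hdp, hdq, hA⟩⟩

namespace ReturnPair

variable {A : Type*} {x : ℕ → A} {k : ℕ} {T : ℕ → Prop} {a b : A} {r s p q h : ℕ}

theorem symm (H : ReturnPair x k T a b r s p q h) : ReturnPair x k T b a s r q p h :=
  ⟨H.toUniqueBranching.symm, H.right, H.left, H.letter_right, H.letter_left, H.lt_right, H.lt_left,
    H.agree_ends.symm, fun d h1 h2 h3 hA => H.not_agree d h1 h3 h2 hA.symm⟩

theorem agree_left (H : ReturnPair x k T a b r s p q h) {t : ℕ} (ht : T t) (hta : x (t + k) = a) :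
    Agree x (k + p) r t :=
  H.agree_of_isReturn H.left ht (H.letter_left.trans hta.symm)

theorem isReturn_left (H : ReturnPair x k T a b r s p q h) {t : ℕ} (ht : T t)
    (hta : x (t + k) = a) : IsReturn T t p :=
  H.isReturn_of_isReturn H.left ht (H.letter_left.trans hta.symm)

/-- The blocks of length `k` on a return are pairwise distinct. -/
theorem dist_eq (H : ReturnPair x k T a b r s p q h) {i j d e : ℕ} (hij : Agree x k i j)
    (hi : T (i + d)) (hi' : ∀ c < d, ¬ T (i + c)) (hj : T (j + e)) (hj' : ∀ c < e, ¬ T (j + c)) :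
    d = e := by
  rcases lt_trichotomy d e with hde | hde | hde
  · have h1 := H.extend hij d hi'
    exact absurd ((H.mem_iff h1 le_rfl).mp hi) (hj' d hde)
  · exact hde
  · have h1 := H.extend hij.symm e hj'
    exact absurd ((H.mem_iff h1 le_rfl).mp hj) (hi' e hde)

/-- The two cycles have `p + q - h - 1` distinct blocks, since they merge exactly for the last `h +
1` positions. Blocks are told apart by their distance to the next element of `T`. -/
theorem add_add_le_subwordComplexity [Finite A] (H : ReturnPair x k T a b r s p q h) {f : ℕ}
    (hf : ∀ i < f, ∀ j, i < j → ¬ Agree x k i j) (hr : f ≤ r) (hs : f ≤ s) :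
    f + p + q ≤ subwordComplexity x k + h + 1 := by
  have hhp := H.lt_left
  have hhq := H.lt_right
  have hA : ∀ d < p, T (r + p - d + d) ∧ ∀ c < d, ¬ T (r + p - d + c) := by
    intro d hd
    refine ⟨by rw [Nat.sub_add_cancel (by omega)]; exact H.left.right, fun c hc => ?_⟩
    rw [show r + p - d + c = r + (p - d + c) by omega]
    exact H.left.gap _ (by omega) (by omega)
  have hB : ∀ d < q, T (s + q - d + d) ∧ ∀ c < d, ¬ T (s + q - d + c) := by
    intro d hd
    refine ⟨by rw [Nat.sub_add_cancel (by omega)]; exact H.right.right, fun c hc => ?_⟩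
    rw [show s + q - d + c = s + (q - d + c) by omega]
    exact H.right.gap _ (by omega) (by omega)
  set S₁ := Finset.range f
  set S₂ := Finset.Ioc r (r + p)
  -- Omits the positions at distance `0, …, h` from the end, already counted in `S₂`.
  set S₃ := Finset.Ioo s (s + q - h)
  have e₂ : ∀ i ∈ S₂, ∃ d < p, i = r + p - d := fun i hi => by
    rw [Finset.mem_Ioc] at hi
    exact ⟨r + p - i, by omega, by omega⟩
  have e₃ : ∀ i ∈ S₃, ∃ d < q, h < d ∧ i = s + q - d := fun i hi => by
    rw [Finset.mem_Ioo] at hi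
    exact ⟨s + q - i, by omega, by omega, by omega⟩
  have h22 : ∀ i ∈ S₂, ∀ j ∈ S₂, Agree x k i j → i = j := by
    intro i hi j hj hij
    obtain ⟨d, hd, rfl⟩ := e₂ i hi
    obtain ⟨e, he, rfl⟩ := e₂ j hj
    rw [H.dist_eq hij (hA d hd).1 (hA d hd).2 (hA e he).1 (hA e he).2]
  have h33 : ∀ i ∈ S₃, ∀ j ∈ S₃, Agree x k i j → i = j := by
    intro i hi j hj hij
    obtain ⟨d, hd, -, rfl⟩ := e₃ i hi
    obtain ⟨e, he, -, rfl⟩ := e₃ j hj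
    rw [H.dist_eq hij (hB d hd).1 (hB d hd).2 (hB e he).1 (hB e he).2]
  have h23 : ∀ i ∈ S₂, ∀ j ∈ S₃, ¬ Agree x k i j := by
    intro i hi j hj hij
    obtain ⟨d, hd, rfl⟩ := e₂ i hi
    obtain ⟨e, he, hhe, rfl⟩ := e₃ j hj
    obtain rfl := H.dist_eq hij (hA d hd).1 (hA d hd).2 (hB e he).1 (hB e he).2
    exact H.not_agree d hhe hd he (H.extend hij d (hA d hd).2)
  have h11 : ∀ i ∈ S₁, ∀ j, Agree x k i j → f ≤ j → False := by
    intro i hi j hij hj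
    rw [Finset.mem_range] at hi
    exact hf i hi j (by omega) hij
  have g₂ : ∀ i ∈ S₂, f ≤ i := fun i hi => by rw [Finset.mem_Ioc] at hi; omega
  have g₃ : ∀ i ∈ S₃, f ≤ i := fun i hi => by rw [Finset.mem_Ioo] at hi; omega
  have d₂₃ : Disjoint S₂ S₃ := by
    rw [Finset.disjoint_left]
    exact fun i hi hi' => h23 i hi i hi' (Agree.refl x k i)
  have d₁ : Disjoint S₁ (S₂ ∪ S₃) := by
    rw [Finset.disjoint_left]
    intro i hi hi'
    refine h11 i hi i (Agree.refl x k i) ?_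
    rcases Finset.mem_union.mp hi' with h' | h'
    exacts [g₂ i h', g₃ i h']
  have key := card_le_subwordComplexity (x := x) (n := k) (S₁ ∪ (S₂ ∪ S₃)) (by
    intro i hi j hj hij
    rw [Finset.mem_union, Finset.mem_union] at hi hj
    rcases hi with hi | hi | hi <;> rcases hj with hj | hj | hj
    · rw [Finset.mem_range] at hi hj
      by_contra hne
      rcases lt_or_gt_of_ne hne with h' | h'
      · exact hf i hi j h' hij
      · exact hf j hj i h' hij.symm
    · exact (h11 i hi j hij (g₂ j hj)).elim
    · exact (h11 i hi j hij (g₃ j hj)).elim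
    · exact (h11 j hj i hij.symm (g₂ i hi)).elim
    · exact h22 i hi j hj hij
    · exact (h23 i hi j hj hij).elim
    · exact (h11 j hj i hij.symm (g₃ i hi)).elim
    · exact (h23 j hj i hi hij.symm).elim
    · exact h33 i hi j hj hij)
  rw [Finset.card_union_of_disjoint d₁, Finset.card_union_of_disjoint d₂₃] at key
  simp only [S₁, S₂, S₃, Finset.card_range, Nat.card_Ioc, Nat.card_Ioo] at key
  omega

end ReturnPair

/-! ### Locating the first recurrent block on a return -/

/-- A return pair together with the first position `f` whose block of length `k` occurs again: the
first occurrence of the right special block is `f + g`, and `f` lies on the second return. -/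
structure StartedReturnPair {A : Type*} (x : ℕ → A) (k : ℕ) (T : ℕ → Prop) (a b : A)
    (r s p q h f g : ℕ) : Prop extends ReturnPair x k T a b r s p q h where
  start_mem : T (f + g)
  start_lt : g < q
  start_agree : Agree x (k + g) f (s + q - g)

theorem Aperiodic.exists_startedReturnPair {A : Type*} [Finite A] {x : ℕ → A} (hx : Aperiodic x)
    {k : ℕ} (hk : subwordComplexity x (k + 1) ≤ subwordComplexity x k + 1) :
    ∃ (T : ℕ → Prop) (a b : A) (r s p q h f g : ℕ), StartedReturnPair x k T a b r s p q h f g ∧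
      f + k + 1 ≤ subwordComplexity x k ∧ f + p + q ≤ subwordComplexity x k + h + 1 := by
  classical
  obtain ⟨T, a, b, H⟩ := hx.exists_uniqueBranching hk
  have hex : ∃ f j, f < j ∧ Agree x k f j := by
    obtain ⟨i, -, hi, -⟩ := H.infinite_left 0
    obtain ⟨j, hj, hj', -⟩ := H.infinite_left (i + 1)
    exact ⟨i, j, by omega, H.agree hi hj'⟩
  obtain ⟨f, ⟨j, hfj, hagree⟩, hfmin⟩ : ∃ f, (∃ j, f < j ∧ Agree x k f j) ∧
      ∀ i < f, ∀ j, i < j → ¬ Agree x k i j :=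
    ⟨Nat.find hex, Nat.find_spec hex, fun i hi j hj hA => Nat.find_min hex hi ⟨j, hj, hA⟩⟩
  have hexg : ∃ g, T (f + g) := by
    obtain ⟨i, hi, hi', -⟩ := H.infinite_left f
    exact ⟨i - f, by rwa [Nat.add_sub_cancel' hi]⟩
  obtain ⟨g, hg, hgmin⟩ : ∃ g, T (f + g) ∧ ∀ c < g, ¬ T (f + c) :=
    ⟨Nat.find hexg, Nat.find_spec hexg, fun c hc => Nat.find_min hexg hc⟩
  have hfg := H.extend hagree g hgmin
  -- Otherwise `j` lies in `(f, f + g]` and meets `T` after fewer than `g` steps, whereas `f` and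
  -- `j` meet `T` simultaneously.
  have hgj : f + g < j := by
    by_contra! hcon
    have h1 : T (j + (g - (j - f))) := by rwa [show j + (g - (j - f)) = f + g by omega]
    exact hgmin _ (by omega) ((H.mem_iff hfg (by omega)).mpr h1)
  have hjg : T (j + g) := (H.mem_iff hfg le_rfl).mp hg
  have hjmin : ∀ c < g, ¬ T (j + c) := fun c hc hT => hgmin c hc ((H.mem_iff hfg hc.le).mpr hT)
  obtain ⟨t, htj, htT, htmax⟩ : ∃ t < j, T t ∧ ∀ u, t < u → u < j → ¬ T u := by
    have hspec := Nat.findGreatest_spec (P := T) (show f + g ≤ j - 1 by omega) hg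
    refine ⟨Nat.findGreatest T (j - 1), ?_, hspec, fun u hu huj =>
      Nat.findGreatest_is_greatest hu (by omega)⟩
    have := Nat.findGreatest_le (P := T) (j - 1)
    omega
  -- Since `t` is the last element of `T` before `j`, its return passes through `j` and ends at `j +
  -- g`. So `f`, which looks like `j`, sits `g` places before the end of a return; the letter after
  -- `t` decides which one is called the second.
  have hend : ∀ l, IsReturn T t l → t + l = j + g := by
    intro l hl
    have h1 : j ≤ t + l := by
      by_contra! hcon
      exact htmax _ (by have := hl.pos; omega) hcon hl.right
    have h2 : j + g ≤ t + l := by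
      by_contra! hcon
      exact hjmin (t + l - j) (by omega) (by rw [Nat.add_sub_cancel' h1]; exact hl.right)
    by_contra hne
    exact hl.gap (j + g - t) (by omega) (by omega)
      (by rwa [show t + (j + g - t) = j + g by omega])
  have main : ∀ {a b r s p q h}, ReturnPair x k T a b r s p q h → x (t + k) = b →
      StartedReturnPair x k T a b r s p q h f g := by
    intro a b r s p q h R hb
    have h1 := hend q (R.symm.isReturn_left htT hb)
    refine ⟨R, hg, by omega, hfg.trans ?_⟩
    have h2 := (R.symm.agree_left htT hb).shift (m := k + g) (q - g) (by omega)
    rw [show t + (q - g) = j by omega, show s + (q - g) = s + q - g by omega] at h2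
    exact h2.symm
  -- Taking both returns beyond `f` keeps their blocks apart from the `f` initial ones.
  obtain ⟨r, s, p, q, h, hr, hs, R⟩ := H.exists_returnPair f
  have c1 := hx.add_succ_le_subwordComplexity hfmin
  have c2 := R.add_add_le_subwordComplexity hfmin hr hs
  rcases H.letters htT with ha | hb
  · exact ⟨T, b, a, s, r, q, p, h, f, g, main R.symm ha, c1, by omega⟩
  · exact ⟨T, a, b, r, s, p, q, h, f, g, main R hb, c1, c2⟩

namespace ReturnPair

variable {A : Type*} {x : ℕ → A} {k : ℕ} {T : ℕ → Prop} {a b : A} {r s p q h f g : ℕ}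

theorem agree_end_left (H : ReturnPair x k T a b r s p q h) {t d : ℕ} (ht : T t)
    (hta : x (t + k) = a) (hd : d ≤ p) : Agree x (k + d) (r + p - d) (t + p - d) := by
  have h1 := (H.agree_left ht hta).shift (m := k + d) (p - d) (by omega)
  rwa [← Nat.add_sub_assoc hd, ← Nat.add_sub_assoc hd] at h1

theorem period_left (H : ReturnPair x k T a b r s p q h) {d : ℕ} (hd : d ≤ p) :
    Agree x (k + d - p) (r + p - d) (r + p - d + p) := by
  have h1 := (H.agree H.left.left H.left.right).shift (m := k + d - p) (p - d)
  rcases le_or_gt p (k + d) with h2 | h2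
  · have h3 := h1 (by omega)
    rwa [show r + (p - d) = r + p - d by omega, show r + p + (p - d) = r + p - d + p by omega] at h3
  · rw [show k + d - p = 0 by omega]
    intro t ht
    omega

/-- Two occurrences of the special block with the same next letter share a full return, which
lengthens a coincidence reaching them by `p`. -/
theorem agree_of_add (H : ReturnPair x k T a b r s p q h) {t t' : ℕ} (ht : T t) (ht' : T t')
    (hta : x (t + k) = a) (hta' : x (t' + k) = a) {d : ℕ} {i j : ℕ} (hij : Agree x (k + d) i j)
    (hi : i + d = t) (hj : j + d = t') : Agree x (k + p + d) i j := by
  have h1 := (H.agree_left ht hta).symm.trans (H.agree_left ht' hta')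
  subst hi hj
  exact hij.glue d h1 (by omega)

end ReturnPair

/-! ### Repetitions forced by the first returns after the start -/

section Estimates

variable {A : Type*} {x : ℕ → A} {k : ℕ} {T : ℕ → Prop} {a b : A} {r s p q h f g : ℕ} {ν N : ℝ}

/-- A block of length `n` occurring at `i < j` forces `j` to be at least about `n / ν`. -/
def RepetitionBound (x : ℕ → A) (ν N : ℝ) : Prop :=
  ∀ n i j, i < j → Agree x n i j → (n : ℝ) ≤ ν * j + N

/-- The slack `m` allows for coincidences of truncated length, such as `k + g - q`, which may be
empty. -/
theorem RepetitionBound.le (hD : RepetitionBound x ν N) {n i j d J m L : ℕ} (hA : Agree x n i j)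
    (hij : i < j) (hJ : j + d = J) (hL : L ≤ n + m) : (L : ℝ) ≤ ν * (J - d) + N + m := by
  have h1 := hD n i j hij hA
  have h2 : (L : ℝ) ≤ n + m := by exact_mod_cast hL
  have h3 : (J : ℝ) = j + d := by exact_mod_cast hJ.symm
  rw [h3, add_sub_cancel_right]
  linarith

/-- The estimates available when the start lies on both returns. -/
theorem ReturnPair.common_start_estimates (H : ReturnPair x k T a b r s p q h)
    (hD : RepetitionBound x ν N) (hgh : g ≤ h) (hfg : T (f + g)) (hp : Agree x (k + g) f (r + p - g))
    (hq : Agree x (k + g) f (s + q - g)) (h1 : x (f + g + k) = a) :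
    (k + g + p : ℝ) ≤ ν * (f + p) + N ∨
    ((k + g : ℝ) ≤ ν * (f + p) + N ∧ (k + g + p : ℝ) ≤ ν * (f + p + q) + N ∧
      (k + h : ℝ) ≤ ν * (f + g + p + q - h) + N) ∨
    ((k + g : ℝ) ≤ ν * (f + p) + N ∧ (k + h + q : ℝ) ≤ ν * (f + g + p + q - h) + N ∧
      (k + g : ℝ) ≤ ν * (f + q) + N + q) := by
  have hhp := H.lt_left
  have hhq := H.lt_right
  have a12 : Agree x (k + g) f (f + p) := by
    have := H.agree_end_left (d := g) hfg h1 (by omega)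
    rw [show f + g + p - g = f + p by omega] at this
    exact hp.trans this
  have e1 : ((k + g : ℕ) : ℝ) ≤ ν * ((f + p : ℕ) - (0 : ℕ)) + N + (0 : ℕ) :=
    hD.le a12 (by omega) rfl le_rfl
  have T2 : T (f + g + p) := (H.isReturn_left hfg h1).right
  -- The three alternatives are the letter patterns `aa`, `aba`, `abb` at the successive occurrences
  -- from `f + g` on.
  rcases H.letters T2 with h2 | h2
  · left
    have := H.agree_of_add hfg T2 h1 h2 a12 rfl (by omega)
    have := hD.le (d := 0) (J := f + p) (m := 0) (L := k + g + p) this (by omega) rfl (by omega)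
    push_cast at this
    linarith
  have T3 : T (f + g + p + q) := (H.symm.isReturn_left T2 h2).right
  have a23 : Agree x (k + h) (f + g + p - h) (f + g + p + q - h) :=
    (H.agree_end_left hfg h1 hhp.le).symm.trans
      (H.agree_ends.trans (H.symm.agree_end_left T2 h2 hhq.le))
  right
  rcases H.letters T3 with h3 | h3
  · left
    have a13 : Agree x (k + g) f (f + p + q) := by
      have := H.symm.agree_end_left (d := g) T2 h2 (by omega)
      rw [show f + g + p + q - g = f + p + q by omega] at this
      exact hq.trans this
    have e2 := hD.le (d := 0) (J := f + p + q) (m := 0) (L := k + g + p)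
      (H.agree_of_add hfg T3 h1 h3 a13 rfl (by omega)) (by omega) rfl (by omega)
    have e3 := hD.le (d := h) (J := f + g + p + q) (m := 0) (L := k + h)
      a23 (by omega) (by omega) (by omega)
    push_cast at e1 e2 e3
    exact ⟨by linarith, by linarith, by linarith⟩
  · right
    have e2 := hD.le (d := h) (J := f + g + p + q) (m := 0) (L := k + h + q)
      (H.symm.agree_of_add T2 T3 h2 h3 a23 (by omega) (by omega)) (by omega) (by omega) (by omega)
    have e3 : ((k + g : ℕ) : ℝ) ≤ ν * ((f + q : ℕ) - (0 : ℕ)) + N + q := by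
      -- A `b`-return makes its starting block overlap itself with period `q`, and the block at `f`
      -- inherits this. If `q > k + g` the empty repetition already gives the bound.
      rcases le_or_gt q (k + g) with hqk | hqk
      · exact hD.le ((H.symm.period_left (d := g) (by omega)).period hq.symm (by omega))
          (by omega) rfl (by omega)
      · exact hD.le (n := 0) (i := f) (j := f + q) (fun t ht => by omega) (by omega) rfl (by omega)
    push_cast at e1 e2 e3
    exact ⟨by linarith, by linarith, by linarith⟩

/-- The estimates available when the start lies on the second return only. -/
theorem StartedReturnPair.right_start_estimates (H : StartedReturnPair x k T a b r s p q h f g)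
    (hD : RepetitionBound x ν N) (hgh : h < g) :
    ((k + h + p : ℝ) ≤ ν * (f + g + p - h) + N ∧ (k : ℝ) ≤ ν * (f + p) + N + (q - g + p)) ∨
    ((k + h : ℝ) ≤ ν * (f + g + p - h) + N ∧ (k + g : ℝ) ≤ ν * (f + p + q) + N ∧
      (k + g : ℝ) ≤ ν * (f + q) + N + q) ∨
    ((k + g : ℝ) ≤ ν * (f + q) + N ∧ (k + h : ℝ) ≤ ν * (f + g + p - h) + N + p) := by
  have hhp := H.lt_left
  have hhq := H.lt_right
  have hgq := H.start_lt
  have hfg := H.start_mem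
  have hq := H.start_agree
  have a0 : Agree x (k + h) (f + g - h) (r + p - h) := by
    have := hq.shift (m := k + h) (g - h) (by omega)
    rw [show f + (g - h) = f + g - h by omega, show s + q - g + (g - h) = s + q - h by omega] at this
    exact this.trans H.agree_ends.symm
  -- The alternatives are the letter patterns `aa`, `ab`, `b`.
  rcases H.letters hfg with h1 | h1
  · have T2 : T (f + g + p) := (H.isReturn_left hfg h1).right
    have a12 : Agree x (k + h) (f + g - h) (f + g + p - h) :=
      a0.trans (H.agree_end_left hfg h1 hhp.le)
    rcases H.letters T2 with h2 | h2
    · left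
      have e1 := hD.le (d := h) (J := f + g + p) (m := 0) (L := k + h + p)
        (H.agree_of_add hfg T2 h1 h2 a12 (by omega) (by omega)) (by omega) (by omega) (by omega)
      have e2 : (k : ℝ) ≤ ν * ((f + p : ℕ) - (0 : ℕ)) + N + (q - g + p : ℕ) := by
        rcases le_or_gt (q - g + p) k with hk | hk
        · have a1 : Agree x (k - (q - g + p)) (s + q - g) (s + q - g + p) := by
            have h3 : Agree x (k - p) s (s + p) := by
              have h4 := H.agree H.left.left H.left.right
              exact (h4.mono (m := k - p) (by omega)).period
                (H.agree H.left.left H.right.left) (by omega)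
            have h5 := h3.shift (m := k - (q - g + p)) (q - g) (by omega)
            rwa [show s + (q - g) = s + q - g by omega,
              show s + p + (q - g) = s + q - g + p by omega] at h5
          exact hD.le (a1.period hq.symm (by omega)) (by omega) rfl (by omega)
        · exact hD.le (n := 0) (i := f) (j := f + p) (fun t ht => by omega) (by omega) rfl
            (by omega)
      rw [Nat.cast_add (q - g), Nat.cast_sub hgq.le] at e2
      push_cast at e1 e2
      exact ⟨by linarith, by linarith⟩
    · right; left
      have e1 := hD.le (d := h) (J := f + g + p) (m := 0) (L := k + h)
        a12 (by omega) (by omega) (by omega)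
      have a13 : Agree x (k + g) f (f + p + q) := by
        have := H.symm.agree_end_left (d := g) T2 h2 (by omega)
        rw [show f + g + p + q - g = f + p + q by omega] at this
        exact hq.trans this
      have e2 := hD.le (d := 0) (J := f + p + q) (m := 0) (L := k + g)
        a13 (by omega) rfl (by omega)
      have e3 : ((k + g : ℕ) : ℝ) ≤ ν * ((f + q : ℕ) - (0 : ℕ)) + N + q := by
        rcases le_or_gt q (k + g) with hqk | hqk
        · exact hD.le ((H.symm.period_left (d := g) (by omega)).period hq.symm (by omega))
            (by omega) rfl (by omega)
        · exact hD.le (n := 0) (i := f) (j := f + q) (fun t ht => by omega) (by omega) rfl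
            (by omega)
      push_cast at e1 e2 e3
      exact ⟨by linarith, by linarith, by linarith⟩
  · right; right
    have a12 : Agree x (k + g) f (f + q) := by
      have := H.symm.agree_end_left (d := g) hfg h1 (by omega)
      rw [show f + g + q - g = f + q by omega] at this
      exact hq.trans this
    have e1 := hD.le (d := 0) (J := f + q) (m := 0) (L := k + g) a12 (by omega) rfl (by omega)
    have e2 : ((k + h : ℕ) : ℝ) ≤ ν * ((f + g + p : ℕ) - (h : ℕ)) + N + p := by
      rcases le_or_gt p (k + h) with hpk | hpk
      · exact hD.le ((H.period_left (d := h) (by omega)).period a0.symm (by omega))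
          (by omega) (by omega) (by omega)
      · exact hD.le (n := 0) (i := f) (j := f + g + p - h) (fun t ht => by omega) (by omega)
          (by omega) (by omega)
    push_cast at e1 e2
    exact ⟨by linarith, by linarith⟩

end Estimates

/-! ### Eliminating the return parameters -/

section Arithmetic

variable {ν N k P f g h p q : ℝ}

/-- Brings an estimate of slope `α / β ≥ Y` to the common normalisation; `13` is the value of `2ν² +
2ν + 1` at `ν = 2`. -/
theorem le_of_slope_le {α β C : ℝ} (hν : 1 ≤ ν) (hν' : ν ≤ 2) (hP : 0 ≤ P) (hα : 1 ≤ α)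
    (hC : 0 ≤ C) (hαβ : β * (2 * ν ^ 2 + 2 * ν + 1) ≤ ν * (ν + 1) ^ 2 * α)
    (h : α * k ≤ β * P + C) :
    (2 * ν ^ 2 + 2 * ν + 1) * k ≤ ν * (ν + 1) ^ 2 * P + 13 * C := by
  have hY : 0 < 2 * ν ^ 2 + 2 * ν + 1 := by positivity
  have hY' : 2 * ν ^ 2 + 2 * ν + 1 ≤ 13 := by nlinarith
  have h1 := mul_le_mul_of_nonneg_left h hY.le
  have h2 := mul_le_mul_of_nonneg_right hαβ hP
  have h3 := mul_le_mul_of_nonneg_right hY' hC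
  have h4 := mul_le_mul_of_nonneg_right hα (by positivity : 0 ≤ 13 * C)
  refine le_of_mul_le_mul_left ?_ (zero_lt_one.trans_le hα)
  linarith

/-- Each alternative is a positive linear combination of its estimates with the two counting bounds,
chosen to remove `f, g, h, p, q`. The constant `100 * (N + 1)` is a generous bound for all the error
terms. -/
theorem common_start_slope (hν : 1 ≤ ν) (hν3 : ν ^ 3 ≤ ν + 1) (hN : 0 ≤ N) (hP : 0 ≤ P)
    (hf : f + k + 1 ≤ P) (hpq : f + p + q ≤ P + h + 1) (hg : 0 ≤ g)
    (hhq : h + 1 ≤ q)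
    (H : (k + g + p : ℝ) ≤ ν * (f + p) + N ∨
      ((k + g : ℝ) ≤ ν * (f + p) + N ∧ (k + g + p : ℝ) ≤ ν * (f + p + q) + N ∧
        (k + h : ℝ) ≤ ν * (f + g + p + q - h) + N) ∨
      ((k + g : ℝ) ≤ ν * (f + p) + N ∧ (k + h + q : ℝ) ≤ ν * (f + g + p + q - h) + N ∧
        (k + g : ℝ) ≤ ν * (f + q) + N + q)) :
    (2 * ν ^ 2 + 2 * ν + 1) * k ≤ ν * (ν + 1) ^ 2 * P + 13 * (100 * (N + 1)) := by
  have hν2 : ν ≤ 2 := by nlinarith [sq_nonneg (ν - 2), sq_nonneg ν]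
  have hν0 : 0 ≤ ν := by linarith
  have s1 := mul_le_mul_of_nonneg_left hpq hν0
  have hνν : ν ^ 2 ≤ 4 := by nlinarith
  have n1 := mul_le_mul_of_nonneg_right hν2 hN
  have n2 := mul_le_mul_of_nonneg_right hνν hN
  rcases H with e1 | ⟨e1, e2, e3⟩ | ⟨e1, e2, e3⟩
  · refine le_of_slope_le (α := 2) (β := ν) hν hν2 hP (by norm_num) (by positivity) ?_ ?_
    · nlinarith
    · have := mul_le_mul_of_nonneg_left (show f + p ≤ P by linarith) (show 0 ≤ ν - 1 by linarith)
      linarith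
  · refine le_of_slope_le (α := (ν + 1) ^ 2) (β := ν * (ν ^ 2 + ν + 1)) hν hν2 hP (by nlinarith)
      (by positivity) ?_ ?_
    · nlinarith [mul_nonneg (mul_nonneg hν0 hν0) (sub_nonneg.mpr hν3)]
    · have h1 : k + h ≤ ν * (P + 1 + g) + N := by linarith
      have h2 : k + g + p ≤ ν * (P + 1 + h) + N := by linarith
      have h3 := mul_le_mul_of_nonneg_left h2 hν0
      have h4 := mul_le_mul_of_nonneg_left h1 (mul_nonneg hν0 hν0)
      have h5 := mul_le_mul_of_nonneg_left hf hν0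
      have h6 := mul_nonneg hg (sub_nonneg.mpr hν3)
      nlinarith
  · refine le_of_slope_le (α := (1 + ν) * (1 + 3 * ν)) (β := ν * (ν ^ 2 + 4 * ν + 1)) hν hν2 hP
      (by nlinarith) (by positivity) ?_ ?_
    · have : 0 ≤ ν ^ 5 + ν ^ 3 := by positivity
      nlinarith
    · have h1 : k + g ≤ ν * (P + 1 + h - q) + N := by linarith
      have h2 := mul_le_mul_of_nonneg_left
        (show k + h + q ≤ ν * (P + 1 + g) + N by linarith) hν0
      have h3 : (1 + ν) * k + g - ν * P - N ≤ (1 + ν) * q := by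
        have := mul_le_mul_of_nonneg_left hf hν0
        linarith
      have h4 := mul_le_mul_of_nonneg_left h3 hν0
      have h5 := mul_le_mul_of_nonneg_left (add_le_add h1 h2) (show 0 ≤ ν + 1 by linarith)
      have h6 : 0 ≤ g * (3 * ν + 1 - ν ^ 3 - ν ^ 2) := mul_nonneg hg (by nlinarith)
      nlinarith

theorem right_start_slope (hν : 1 ≤ ν) (hν3 : ν ^ 3 ≤ ν + 1) (hN : 0 ≤ N) (hP : 0 ≤ P)
    (hf : f + k + 1 ≤ P) (hpq : f + p + q ≤ P + h + 1) (hg : 0 ≤ g) (hh : 0 ≤ h) (hgq : g ≤ q)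
    (H : ((k + h + p : ℝ) ≤ ν * (f + g + p - h) + N ∧ (k : ℝ) ≤ ν * (f + p) + N + (q - g + p)) ∨
      ((k + h : ℝ) ≤ ν * (f + g + p - h) + N ∧ (k + g : ℝ) ≤ ν * (f + p + q) + N ∧
        (k + g : ℝ) ≤ ν * (f + q) + N + q) ∨
      ((k + g : ℝ) ≤ ν * (f + q) + N ∧ (k + h : ℝ) ≤ ν * (f + g + p - h) + N + p)) :
    (2 * ν ^ 2 + 2 * ν + 1) * k ≤ ν * (ν + 1) ^ 2 * P + 13 * (100 * (N + 1)) := by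
  have hν2 : ν ≤ 2 := by nlinarith [sq_nonneg (ν - 2), sq_nonneg ν]
  have hν0 : 0 ≤ ν := by linarith
  have s1 := mul_le_mul_of_nonneg_left hpq hν0
  have s2 := mul_le_mul_of_nonneg_left hf hν0
  have hνν : ν ^ 2 ≤ 4 := by nlinarith
  have n1 := mul_le_mul_of_nonneg_right hν2 hN
  have n2 := mul_le_mul_of_nonneg_right hνν hN
  obtain ⟨e, he, rfl⟩ : ∃ e, 0 ≤ e ∧ q = g + e := ⟨q - g, by linarith, by ring⟩
  rcases H with ⟨e1, e2⟩ | ⟨e1, e2, e3⟩ | ⟨e1, e2⟩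
  · refine le_of_slope_le (α := 2 * (ν + 1)) (β := ν * (ν + 2)) hν hν2 hP (by linarith)
      (by positivity) (by nlinarith) ?_
    have h1 := mul_le_mul_of_nonneg_left (show k + p ≤ ν * (P + 1 - e) + N by linarith)
      (show 0 ≤ ν + 1 by linarith)
    have h2 : k ≤ ν * (P - k) + (ν + 1) * p + e + N := by linarith
    have h3 : 0 ≤ e * (ν * (ν + 1) - 1) := mul_nonneg he (by nlinarith)
    nlinarith
  -- The extremal case, with slope exactly `Y`. The weights `ν + 1`, `ν²`, `ν` cancel `e` and `g`,
  -- and leave `h` with coefficient `ν + 1 - ν³ ≥ 0`.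
  · have h1 : k + h ≤ ν * (P + 1 - e) + N := by linarith
    have h2 := mul_le_mul_of_nonneg_left (show k + g ≤ ν * (P + 1 + h) + N by linarith)
      (mul_nonneg hν0 hν0)
    have h3 := mul_le_mul_of_nonneg_left
      (show k ≤ ν * (P - k) + ν * g + (ν + 1) * e + N by linarith) hν0
    have h4 := mul_le_mul_of_nonneg_left h1 (show 0 ≤ ν + 1 by linarith)
    have h5 := mul_nonneg hh (sub_nonneg.mpr hν3)
    nlinarith
  · refine le_of_slope_le (α := (ν + 1) ^ 2) (β := ν * (2 * ν + 1)) hν hν2 hP (by nlinarith)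
      (by positivity) ?_ ?_
    · have : 0 ≤ ν ^ 5 := by positivity
      nlinarith
    · have h1 := mul_le_mul_of_nonneg_left
        (show k + g ≤ ν * (P + 1 + h - p) + N by linarith) (show 0 ≤ ν + 1 by linarith)
      have h2 := mul_le_mul_of_nonneg_left
        (show k + h ≤ ν * (P - k + g - h) + (ν + 1) * p + N by linarith) hν0
      have h3 : 0 ≤ g * (ν + 1 - ν ^ 2) := mul_nonneg hg (by nlinarith)
      nlinarith

end Arithmetic

/-! ### From slow growth steps to a linear lower bound -/

section

variable {A : Type*} {x : ℕ → A} {ν N : ℝ}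

theorem RepetitionBound.aperiodic (hD : RepetitionBound x ν N) : Aperiodic x := by
  intro i j hij
  by_contra! H
  obtain ⟨n, hn⟩ := exists_nat_gt (ν * j + N)
  exact absurd (hD n i j hij (H n)) (not_le.mpr hn)

variable [Finite A]

theorem RepetitionBound.le_of_succ_le (hD : RepetitionBound x ν N) (hν : 1 ≤ ν)
    (hν3 : ν ^ 3 ≤ ν + 1) (hN : 0 ≤ N) {k : ℕ}
    (hk : subwordComplexity x (k + 1) ≤ subwordComplexity x k + 1) :
    (2 * ν ^ 2 + 2 * ν + 1) * k ≤
      ν * (ν + 1) ^ 2 * subwordComplexity x k + 13 * (100 * (N + 1)) := by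
  obtain ⟨T, a, b, r, s, p, q, h, f, g, H, c1, c2⟩ := hD.aperiodic.exists_startedReturnPair hk
  have hhp := H.lt_left
  have hhq := H.lt_right
  have hgq := H.start_lt
  have c1' : (f : ℝ) + k + 1 ≤ subwordComplexity x k := by exact_mod_cast c1
  have c2' : (f : ℝ) + p + q ≤ subwordComplexity x k + h + 1 := by exact_mod_cast c2
  have hP : (0 : ℝ) ≤ subwordComplexity x k := Nat.cast_nonneg _
  rcases lt_or_ge h g with hgh | hgh
  · exact right_start_slope hν hν3 hN hP c1' c2' (Nat.cast_nonneg _) (Nat.cast_nonneg _)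
      (by exact_mod_cast hgq.le) (H.right_start_estimates hD hgh)
  · have hp : Agree x (k + g) f (r + p - g) := by
      have := H.agree_ends.shift (m := k + g) (h - g) (by omega)
      rw [show r + p - h + (h - g) = r + p - g by omega,
        show s + q - h + (h - g) = s + q - g by omega] at this
      exact H.start_agree.trans this.symm
    rcases H.letters H.start_mem with h1 | h1
    · exact common_start_slope hν hν3 hN hP c1' c2' (Nat.cast_nonneg _)
        (by exact_mod_cast hhq)
        (H.common_start_estimates hD hgh H.start_mem hp H.start_agree h1)
    · exact common_start_slope hν hν3 hN hP c1' (by linarith) (Nat.cast_nonneg _)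
        (by exact_mod_cast hhp)
        (H.symm.common_start_estimates hD hgh H.start_mem H.start_agree hp h1)

theorem RepetitionBound.exists_le_subwordComplexity (hD : RepetitionBound x ν N) (hν : 1 ≤ ν)
    (hν3 : ν ^ 3 ≤ ν + 1) (hN : 0 ≤ N) :
    ∃ C : ℝ, ∀ n : ℕ, (2 * ν ^ 2 + 2 * ν + 1) / (ν * (ν + 1) ^ 2) * n ≤ subwordComplexity x n + C := by
  have hpos : 0 < ν * (ν + 1) ^ 2 := by positivity
  set Y := (2 * ν ^ 2 + 2 * ν + 1) / (ν * (ν + 1) ^ 2) with hY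
  -- A step where the complexity grows by at least `2` therefore preserves the induction hypothesis;
  -- at any other step the bound is obtained afresh, so errors do not accumulate.
  have hY2 : Y ≤ 2 := by
    rw [hY, div_le_iff₀ hpos]
    nlinarith [mul_pos hpos hpos, mul_nonneg (sub_nonneg.mpr hν) (sub_nonneg.mpr hν)]
  set C := 13 * (100 * (N + 1)) / (ν * (ν + 1) ^ 2) with hC
  have hC0 : 0 ≤ C := by positivity
  refine ⟨C + 1, fun n => ?_⟩
  induction n with
  | zero =>
    have : (0 : ℝ) ≤ subwordComplexity x 0 := Nat.cast_nonneg _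
    push_cast
    linarith
  | succ n ih =>
    have hlt := hD.aperiodic.subwordComplexity_lt_succ n
    rcases le_or_gt (subwordComplexity x (n + 1)) (subwordComplexity x n + 1) with hk | hk
    · have h1 := hD.le_of_succ_le hν hν3 hN hk
      have h2 : Y * n ≤ subwordComplexity x n + C := by
        rw [hY, hC, div_mul_eq_mul_div, div_le_iff₀ hpos,
          add_mul (subwordComplexity x n : ℝ), div_mul_cancel₀ _ hpos.ne']
        linarith
      have h3 : (subwordComplexity x n : ℝ) + 1 ≤ subwordComplexity x (n + 1) := by
        exact_mod_cast hlt
      push_cast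
      linarith
    · have h3 : (subwordComplexity x n : ℝ) + 2 ≤ subwordComplexity x (n + 1) := by
        exact_mod_cast hk
      push_cast
      linarith

end

/-! ### Repetitions of digits and rational approximation -/

/-- The digits of a real number in base `b` are the increments of the integer parts. -/
theorem floor_pow_succ_mul_fract {b : ℕ} [NeZero b] (ξ : ℝ) (m : ℕ) :
    (⌊(b : ℝ) ^ (m + 1) * Int.fract ξ⌋₊ : ℝ) =
      b * ⌊(b : ℝ) ^ m * Int.fract ξ⌋₊ + (baryExpansion b ξ m : ℕ) := by
  have hb : (b : ℝ) ≠ 0 := Nat.cast_ne_zero.mpr (NeZero.ne b)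
  have hx : Int.fract ξ ∈ Set.Ico (0 : ℝ) 1 := ⟨Int.fract_nonneg ξ, Int.fract_lt_one ξ⟩
  rw [← Real.ofDigits_digits_sum_eq hx, ← Real.ofDigits_digits_sum_eq hx, Finset.sum_range_succ,
    Real.ofDigitsTerm, baryExpansion]
  field_simp
  ring

theorem agree_baryExpansion {b : ℕ} [NeZero b] {ξ : ℝ} {n i j : ℕ}
    (h : Agree (baryExpansion b ξ) n i j) :
    (⌊(b : ℝ) ^ (j + n) * Int.fract ξ⌋₊ : ℝ) - ⌊(b : ℝ) ^ (i + n) * Int.fract ξ⌋₊ =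
      b ^ n * (⌊(b : ℝ) ^ j * Int.fract ξ⌋₊ - ⌊(b : ℝ) ^ i * Int.fract ξ⌋₊) := by
  induction n with
  | zero => simp
  | succ n ih =>
    rw [← add_assoc, ← add_assoc, floor_pow_succ_mul_fract, floor_pow_succ_mul_fract,
      h n (by omega)]
    have := ih (h.mono (by omega))
    rw [pow_succ]
    linear_combination (b : ℝ) * this

/-- Repetitions in the expansion of `ξ` give good rational approximations of `ξ`. -/
theorem exists_int_abs_sub_div_lt {b : ℕ} [NeZero b] (hb : 2 ≤ b) (ξ : ℝ) {i j : ℕ} (hij : i < j) :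
    ∃ M : ℤ, ∀ n, Agree (baryExpansion b ξ) n i j →
      |ξ - M / ((b : ℝ) ^ j - b ^ i)| < 1 / ((b : ℝ) ^ n * (b ^ j - b ^ i)) := by
  have hb1 : (1 : ℝ) < b := by exact_mod_cast hb
  have hQ : (0 : ℝ) < b ^ j - b ^ i := sub_pos.mpr (pow_lt_pow_right₀ hb1 hij)
  set u := ⌊(b : ℝ) ^ i * Int.fract ξ⌋₊ with hu
  set v := ⌊(b : ℝ) ^ j * Int.fract ξ⌋₊ with hv
  -- The numerator does not depend on `n`, so an infinite repetition would force `ξ` to be rational.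
  refine ⟨⌊ξ⌋ * ((b : ℤ) ^ j - b ^ i) + v - u, fun n h => ?_⟩
  have hn : (0 : ℝ) < b ^ n := by positivity
  have key := agree_baryExpansion h
  rw [← hu, ← hv] at key
  have hpos : ∀ m : ℕ, 0 ≤ (b : ℝ) ^ m * Int.fract ξ := fun m =>
    mul_nonneg (by positivity) (Int.fract_nonneg ξ)
  have l1 := Nat.floor_le (hpos (i + n))
  have l2 := Nat.lt_floor_add_one ((b : ℝ) ^ (i + n) * Int.fract ξ)
  have l3 := Nat.floor_le (hpos (j + n))
  have l4 := Nat.lt_floor_add_one ((b : ℝ) ^ (j + n) * Int.fract ξ)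
  have e : ξ - ((⌊ξ⌋ * ((b : ℤ) ^ j - b ^ i) + v - u : ℤ) : ℝ) / ((b : ℝ) ^ j - b ^ i) =
      ((b : ℝ) ^ n * ((b ^ j - b ^ i) * Int.fract ξ - (v - u))) / (b ^ n * (b ^ j - b ^ i)) := by
    rw [mul_div_mul_left _ _ hn.ne', eq_div_iff hQ.ne', sub_mul, div_mul_cancel₀ _ hQ.ne', Int.fract]
    push_cast
    ring
  rw [e, abs_div, abs_of_pos (mul_pos hn hQ)]
  refine div_lt_div_of_pos_right ?_ (mul_pos hn hQ)
  have e' : (b : ℝ) ^ n * ((b ^ j - b ^ i) * Int.fract ξ) =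
      (b : ℝ) ^ (j + n) * Int.fract ξ - (b : ℝ) ^ (i + n) * Int.fract ξ := by ring
  rw [mul_sub, ← key, abs_lt, e']
  constructor <;> linarith

theorem finite_of_irrationalityExponent_lt {ξ t : ℝ} (h : irrationalityExponent ξ < (t : EReal)) :
    {r : ℚ | |ξ - (r : ℝ)| < 1 / (r.den : ℝ) ^ t}.Finite := by
  by_contra hinf
  exact absurd (le_sSup (Set.mem_image_of_mem _ hinf)) (not_le.mpr h)

theorem two_le_irrationalityExponent {ξ : ℝ} (hξ : Irrational ξ) :
    ((2 : ℝ) : EReal) ≤ irrationalityExponent ξ := by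
  refine le_sSup (Set.mem_image_of_mem _ ?_)
  simpa using Real.infinite_rat_abs_sub_lt_one_div_den_sq_of_irrational hξ

theorem exists_pos_le_abs_sub {ξ : ℝ} (hξ : Irrational ξ) {S : Set ℚ} (hS : S.Finite) :
    ∃ c : ℝ, 0 < c ∧ ∀ r ∈ S, c ≤ |ξ - (r : ℝ)| := by
  rcases S.eq_empty_or_nonempty with rfl | hne
  · exact ⟨1, one_pos, by simp⟩
  · obtain ⟨r, -, hr⟩ := Set.exists_min_image S (fun r : ℚ => |ξ - (r : ℝ)|) hS hne
    exact ⟨_, abs_pos.mpr (sub_ne_zero.mpr (hξ.ne_rat r)), hr⟩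

/-- A longer repetition would give a fraction `M / Q` with `Q ≤ b^j` and error below `1 / Q^(1 +
ν)`. Only finitely many rationals are that close, and they stay at distance at least `c` from `ξ`.
-/
theorem exists_repetitionBound {b : ℕ} [NeZero b] (hb : 2 ≤ b) {ξ : ℝ} (hξ : Irrational ξ) {ν : ℝ}
    (hν : 0 ≤ ν) (h : irrationalityExponent ξ < ((1 + ν : ℝ) : EReal)) :
    ∃ N, 0 ≤ N ∧ RepetitionBound (baryExpansion b ξ) ν N := by
  have hb1 : (1 : ℝ) < b := by exact_mod_cast hb
  obtain ⟨c, hc, hcS⟩ := exists_pos_le_abs_sub hξ (finite_of_irrationalityExponent_lt h)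
  -- Chosen so that a violating repetition, having `n ≥ N`, approximates `ξ` to within less than
  -- `c`.
  obtain ⟨N, hN⟩ := pow_unbounded_of_one_lt (1 / c) hb1
  refine ⟨N, Nat.cast_nonneg _, fun n i j hij hA => ?_⟩
  by_contra! hlt
  obtain ⟨M, hM⟩ := exists_int_abs_sub_div_lt hb ξ hij
  replace hM := hM n hA
  have hlt' : b ^ i < b ^ j := Nat.pow_lt_pow_right hb hij
  obtain ⟨Q, hQ⟩ : ∃ Q : ℕ, b ^ i + Q = b ^ j := ⟨b ^ j - b ^ i, by omega⟩
  have hQ0 : 0 < Q := by omega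
  have hQR : (b : ℝ) ^ j - b ^ i = Q := by
    have : (b : ℝ) ^ i + Q = b ^ j := by exact_mod_cast hQ
    linarith
  have hQb : (Q : ℝ) ≤ (b : ℝ) ^ j := by
    have : 0 < (b : ℝ) ^ i := by positivity
    linarith
  rw [hQR] at hM
  have hQ1 : (1 : ℝ) ≤ Q := by exact_mod_cast hQ0
  set r : ℚ := (M : ℚ) / (Q : ℚ) with hr
  have hrR : (M : ℝ) / Q = (r : ℝ) := by simp [hr]
  rw [hrR] at hM
  have hden : (r.den : ℝ) ≤ Q := by
    have h1 : r = Rat.divInt M Q := by rw [hr, Rat.divInt_eq_div]; simp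
    have h2 : (r.den : ℤ) ∣ (Q : ℤ) := by rw [h1]; exact Rat.den_dvd M Q
    exact_mod_cast Nat.le_of_dvd hQ0 (Int.natCast_dvd_natCast.mp h2)
  have hden0 : (0 : ℝ) < r.den := by exact_mod_cast r.den_pos
  have hpow : (r.den : ℝ) ^ (1 + ν) ≤ b ^ n * Q := by
    calc (r.den : ℝ) ^ (1 + ν) ≤ (Q : ℝ) ^ (1 + ν) :=
          Real.rpow_le_rpow hden0.le hden (by linarith)
      _ = (Q : ℝ) ^ ν * Q := by
          rw [add_comm, Real.rpow_add (by linarith), Real.rpow_one]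
      _ ≤ ((b : ℝ) ^ j) ^ ν * Q := by
          gcongr
      _ = (b : ℝ) ^ (ν * j) * Q := by
          rw [← Real.rpow_natCast, ← Real.rpow_mul (by positivity), mul_comm ν]
      _ ≤ (b : ℝ) ^ (n : ℝ) * Q := by
          gcongr
          · exact hb1.le
          · have : (0 : ℝ) ≤ N := Nat.cast_nonneg _
            linarith
      _ = b ^ n * Q := by rw [Real.rpow_natCast]
  have hbn : (0 : ℝ) < b ^ n := by positivity
  have hmem : |ξ - (r : ℝ)| < 1 / (r.den : ℝ) ^ (1 + ν) :=
    hM.trans_le (one_div_le_one_div_of_le (by positivity) hpow)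
  have hc1 : c < 1 / ((b : ℝ) ^ n * Q) := (hcS r hmem).trans_lt hM
  have hNn : N ≤ n := by
    have : (0 : ℝ) ≤ ν * j := by positivity
    have : (N : ℝ) ≤ n := by linarith
    exact_mod_cast this
  have hc2 : (b : ℝ) ^ N ≤ b ^ n * Q :=
    (pow_le_pow_right₀ hb1.le hNn).trans (le_mul_of_one_le_right hbn.le hQ1)
  have hc3 : 1 / ((b : ℝ) ^ n * Q) < c := by
    rw [one_div_lt (by positivity) hc]
    exact hN.trans_le hc2
  exact lt_asymm hc1 hc3

theorem aperiodic_baryExpansion {b : ℕ} [NeZero b] (hb : 2 ≤ b) {ξ : ℝ} (hξ : Irrational ξ) :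
    Aperiodic (baryExpansion b ξ) := by
  have hb1 : (1 : ℝ) < b := by exact_mod_cast hb
  intro i j hij
  by_contra! H
  have hQ : (0 : ℝ) < b ^ j - b ^ i := sub_pos.mpr (pow_lt_pow_right₀ hb1 hij)
  obtain ⟨M, hM⟩ := exists_int_abs_sub_div_lt hb ξ hij
  have hne : ξ - M / ((b : ℝ) ^ j - b ^ i) ≠ 0 := by
    have := hξ.ne_rat (M / ((b : ℚ) ^ j - b ^ i))
    push_cast at this
    exact sub_ne_zero.mpr this
  obtain ⟨n, hn⟩ := pow_unbounded_of_one_lt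
    (1 / (|ξ - M / ((b : ℝ) ^ j - b ^ i)| * (b ^ j - b ^ i))) hb1
  have h1 := hM n (H n)
  rw [lt_div_iff₀ (by positivity)] at h1
  rw [div_lt_iff₀ (mul_pos (abs_pos.mpr hne) hQ)] at hn
  linarith

/-! ### Passage to the lower limit -/

/-- A linear lower bound for the complexity bounds the lower limit of `p(n) / n`. -/
theorem coe_le_liminf_div {u : ℕ → ℕ} {Y C : ℝ} (h : ∀ n : ℕ, Y * n ≤ u n + C) :
    (Y : EReal) ≤ liminf (fun n : ℕ => (((u n : ℝ) / (n : ℝ) : ℝ) : EReal)) atTop := by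
  have h1 : Tendsto (fun n : ℕ => ((Y - C / n : ℝ) : EReal)) atTop (nhds (Y : EReal)) := by
    have h2 : Tendsto (fun n : ℕ => Y - C / (n : ℝ)) atTop (nhds (Y - 0)) :=
      tendsto_const_nhds.sub (tendsto_const_div_atTop_nhds_zero_nat C)
    rw [sub_zero] at h2
    exact (continuous_coe_real_ereal.tendsto Y).comp h2
  rw [← h1.liminf_eq]
  refine liminf_le_liminf ?_
  filter_upwards [eventually_gt_atTop 0] with n hn
  have hn' : (0 : ℝ) < n := by exact_mod_cast hn
  rw [EReal.coe_le_coe_iff, le_div_iff₀ hn', sub_mul, div_mul_cancel₀ _ hn'.ne']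
  linarith [h n]

theorem one_le_liminf_digitComplexity {b : ℕ} [NeZero b] (hb : 2 ≤ b) {ξ : ℝ} (hξ : Irrational ξ) :
    (1 : EReal) ≤ liminf (fun n : ℕ => (((digitComplexity n ξ b : ℝ) / (n : ℝ) : ℝ) : EReal))
      atTop := by
  have := coe_le_liminf_div (u := fun n => digitComplexity n ξ b) (Y := 1) (C := 0) fun n => by
    have h1 := (aperiodic_baryExpansion hb hξ).succ_le_subwordComplexity n
    have h2 : (n : ℝ) + 1 ≤ digitComplexity n ξ b := by exact_mod_cast h1
    linarith
  exact_mod_cast this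

/-- The lower bound for the complexity of a number of irrationality exponent `1 + ν`, which is
better than the trivial one as long as `ν ^ 3 < ν + 1`. -/
theorem coe_le_liminf_digitComplexity {b : ℕ} [NeZero b] (hb : 2 ≤ b) {ξ : ℝ} (hξ : Irrational ξ)
    {ν : ℝ} (hν : 1 ≤ ν) (hν3 : ν ^ 3 < ν + 1)
    (h : irrationalityExponent ξ = ((1 + ν : ℝ) : EReal)) :
    (((2 * ν ^ 2 + 2 * ν + 1) / (ν * (ν + 1) ^ 2) : ℝ) : EReal) ≤
      liminf (fun n : ℕ => (((digitComplexity n ξ b : ℝ) / (n : ℝ) : ℝ) : EReal)) atTop := by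
  have hcont : ContinuousAt (fun ν : ℝ => (2 * ν ^ 2 + 2 * ν + 1) / (ν * (ν + 1) ^ 2)) ν :=
    ContinuousAt.div (by fun_prop) (by fun_prop) (by positivity)
  -- At the exponent `1 + ν` itself there may be infinitely many approximations, so the bound is
  -- proved for `w > ν` and `w` tends to `ν`; the strict inequality `ν³ < ν + 1` persists nearby.
  have hlim : Tendsto (fun ν : ℝ => (((2 * ν ^ 2 + 2 * ν + 1) / (ν * (ν + 1) ^ 2) : ℝ) : EReal))
      (nhdsWithin ν (Set.Ioi ν)) (nhds _) :=
    ((continuous_coe_real_ereal.tendsto _).comp hcont.tendsto).mono_left nhdsWithin_le_nhds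
  refine le_of_tendsto hlim ?_
  have hev : ∀ᶠ w in nhds ν, w ^ 3 < w + 1 :=
    (by fun_prop : Continuous fun w : ℝ => w ^ 3).continuousAt.eventually_lt
      (by fun_prop : Continuous fun w : ℝ => w + 1).continuousAt hν3
  filter_upwards [hev.filter_mono nhdsWithin_le_nhds, self_mem_nhdsWithin] with w hw hw'
  rw [Set.mem_Ioi] at hw'
  obtain ⟨N, hN, hD⟩ := exists_repetitionBound (ν := w) hb hξ (by linarith)
    (by rw [h, EReal.coe_lt_coe_iff]; linarith)
  obtain ⟨C, hC⟩ := hD.exists_le_subwordComplexity (by linarith) hw.le hN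
  exact coe_le_liminf_div (u := fun n => digitComplexity n ξ b) hC

theorem coe_le_liminf_digitComplexity_of_le {b : ℕ} [NeZero b] (hb : 2 ≤ b) {ξ : ℝ}
    (hξ : Irrational ξ) {μ : ℝ} (h : irrationalityExponent ξ = (μ : EReal)) {Z : ℝ}
    (h₁ : ∀ ν, μ = ν + 1 → 1 ≤ ν → ν + 1 ≤ ν ^ 3 → Z ≤ 1)
    (h₂ : ∀ ν, μ = ν + 1 → 1 ≤ ν → ν ^ 3 < ν + 1 →
      Z ≤ (2 * ν ^ 2 + 2 * ν + 1) / (ν * (ν + 1) ^ 2)) :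
    (Z : EReal) ≤
      liminf (fun n : ℕ => (((digitComplexity n ξ b : ℝ) / (n : ℝ) : ℝ) : EReal)) atTop := by
  have hμ : 2 ≤ μ := by
    have := two_le_irrationalityExponent hξ
    rwa [h, EReal.coe_le_coe_iff] at this
  obtain ⟨ν, rfl⟩ : ∃ ν, μ = ν + 1 := ⟨μ - 1, by ring⟩
  rcases lt_or_ge (ν ^ 3) (ν + 1) with h3 | h3
  · exact (EReal.coe_le_coe_iff.mpr (h₂ ν rfl (by linarith) h3)).trans
      (coe_le_liminf_digitComplexity hb hξ (by linarith) h3 (by rw [h, add_comm]))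
  · refine le_trans ?_ (one_le_liminf_digitComplexity hb hξ)
    exact_mod_cast h₁ ν rfl (by linarith) h3

/-! ### Comparison with the stated bounds -/

theorem liminf_slope_le_one {ν : ℝ} (hν : 1 ≤ ν) (h3 : ν + 1 ≤ ν ^ 3) :
    1 + (-(ν + 1) ^ 3 + 2 * (ν + 1) ^ 2 + (ν + 1) - 1) /
      ((ν + 1) ^ 4 - 2 * (ν + 1) ^ 3 + 3 * (ν + 1) ^ 2 - 3 * (ν + 1) + 1) ≤ 1 := by
  have hd : (ν + 1) ^ 4 - 2 * (ν + 1) ^ 3 + 3 * (ν + 1) ^ 2 - 3 * (ν + 1) + 1 =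
      ν * (ν ^ 3 + 2 * ν ^ 2 + 3 * ν + 1) := by ring
  rw [hd]
  have : (-(ν + 1) ^ 3 + 2 * (ν + 1) ^ 2 + (ν + 1) - 1) /
      (ν * (ν ^ 3 + 2 * ν ^ 2 + 3 * ν + 1)) ≤ 0 :=
    div_nonpos_of_nonpos_of_nonneg (by nlinarith) (by positivity)
  linarith

theorem liminf_slope_le {ν : ℝ} (hν : 1 ≤ ν) (h3 : ν ^ 3 < ν + 1) :
    1 + (-(ν + 1) ^ 3 + 2 * (ν + 1) ^ 2 + (ν + 1) - 1) /
      ((ν + 1) ^ 4 - 2 * (ν + 1) ^ 3 + 3 * (ν + 1) ^ 2 - 3 * (ν + 1) + 1) ≤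
      (2 * ν ^ 2 + 2 * ν + 1) / (ν * (ν + 1) ^ 2) := by
  have hν0 : 0 < ν := by linarith
  have hd : (ν + 1) ^ 4 - 2 * (ν + 1) ^ 3 + 3 * (ν + 1) ^ 2 - 3 * (ν + 1) + 1 =
      ν * (ν ^ 3 + 2 * ν ^ 2 + 3 * ν + 1) := by ring
  have hd0 : 0 < ν * (ν ^ 3 + 2 * ν ^ 2 + 3 * ν + 1) := by positivity
  rw [hd, add_comm, div_add_one hd0.ne', div_le_div_iff₀ hd0 (by positivity)]
  -- After cross-multiplication the difference of the two sides is `ν³ (-ν⁴ - ν³ + ν² + 3ν + 1)`,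
  -- whose second factor is this product plus `ν`.
  have h4 : 0 ≤ (ν + 1) * (ν + 1 - ν ^ 3) := mul_nonneg (by positivity) (by linarith)
  have h5 : 0 ≤ -ν ^ 4 - ν ^ 3 + ν ^ 2 + 3 * ν + 1 := by nlinarith
  have h6 : 0 ≤ ν ^ 3 * (-ν ^ 4 - ν ^ 3 + ν ^ 2 + 3 * ν + 1) := mul_nonneg (by positivity) h5
  nlinarith

theorem limsup_slope_le_one {ν : ℝ} (hν : 1 ≤ ν) (h3 : ν + 1 ≤ ν ^ 3) :
    ((ν + 1) + Real.sqrt (4 * (ν + 1 - 1) ^ 3 + (ν + 1) ^ 2)) / (2 * (ν + 1) * (ν + 1 - 1)) ≤ 1 := by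
  rw [add_sub_cancel_right, div_le_one (by positivity)]
  have : Real.sqrt (4 * ν ^ 3 + (ν + 1) ^ 2) ≤ 2 * (ν + 1) * ν - (ν + 1) := by
    refine Real.sqrt_le_iff.mpr ⟨by nlinarith, ?_⟩
    have := mul_nonneg (by positivity : 0 ≤ ν) (sub_nonneg.mpr h3)
    nlinarith
  linarith

theorem limsup_slope_le {ν : ℝ} (hν : 1 ≤ ν) (h3 : ν ^ 3 < ν + 1) :
    ((ν + 1) + Real.sqrt (4 * (ν + 1 - 1) ^ 3 + (ν + 1) ^ 2)) / (2 * (ν + 1) * (ν + 1 - 1)) ≤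
      (2 * ν ^ 2 + 2 * ν + 1) / (ν * (ν + 1) ^ 2) := by
  have hν0 : 0 < ν := by linarith
  rw [add_sub_cancel_right, div_le_div_iff₀ (by positivity) (by positivity)]
  -- This is the claim solved for the square root; squaring and clearing denominators leaves `4ν² (ν
  -- + 1 - ν³) ≥ 0`.
  have h4 : Real.sqrt (4 * ν ^ 3 + (ν + 1) ^ 2) ≤ 2 * (2 * ν ^ 2 + 2 * ν + 1) / (ν + 1) - (ν + 1) := by
    have e : 2 * (2 * ν ^ 2 + 2 * ν + 1) / (ν + 1) - (ν + 1) =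
        (3 * ν ^ 2 + 2 * ν + 1) / (ν + 1) := by
      field_simp
      ring
    rw [e]
    refine Real.sqrt_le_iff.mpr ⟨by positivity, ?_⟩
    rw [div_pow, le_div_iff₀ (by positivity)]
    have := mul_nonneg (by positivity : 0 ≤ ν ^ 2) (sub_nonneg.mpr h3.le)
    nlinarith
  have h5 := mul_le_mul_of_nonneg_right h4 (show 0 ≤ ν * (ν + 1) ^ 2 by positivity)
  have e2 : (2 * (2 * ν ^ 2 + 2 * ν + 1) / (ν + 1) - (ν + 1)) * (ν * (ν + 1) ^ 2) =
      (2 * ν ^ 2 + 2 * ν + 1) * (2 * (ν + 1) * ν) - (ν + 1) * (ν * (ν + 1) ^ 2) := by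
    field_simp
  rw [e2] at h5
  linarith

theorem theorem1p3 (b : ℕ) [NeZero b] (hb : 2 ≤ b) (ξ : ℝ) (hξ : Irrational ξ) :
    (∀ μ : ℝ, irrationalityExponent ξ = (μ : EReal) →
      ((1 + (-μ ^ 3 + 2 * μ ^ 2 + μ - 1) / (μ ^ 4 - 2 * μ ^ 3 + 3 * μ ^ 2 - 3 * μ + 1) : ℝ) : EReal)
          ≤ liminf (fun n : ℕ => (((digitComplexity n ξ b : ℝ) / (n : ℝ) : ℝ) : EReal)) atTop ∧
      (((μ + Real.sqrt (4 * (μ - 1) ^ 3 + μ ^ 2)) / (2 * μ * (μ - 1)) : ℝ) : EReal)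
          ≤ limsup (fun n : ℕ => (((digitComplexity n ξ b : ℝ) / (n : ℝ) : ℝ) : EReal)) atTop) ∧
    (irrationalityExponent ξ = ⊤ →
      (1 : EReal)
          ≤ liminf (fun n : ℕ => (((digitComplexity n ξ b : ℝ) / (n : ℝ) : ℝ) : EReal)) atTop ∧
      (0 : EReal)
          ≤ limsup (fun n : ℕ => (((digitComplexity n ξ b : ℝ) / (n : ℝ) : ℝ) : EReal)) atTop) ∧
    (irrationalityExponent ξ = ((2 : ℝ) : EReal) →
      ((8 / 7 : ℝ) : EReal)
          ≤ liminf (fun n : ℕ => (((digitComplexity n ξ b : ℝ) / (n : ℝ) : ℝ) : EReal)) atTop ∧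
      (((1 + Real.sqrt 2) / 2 : ℝ) : EReal)
          ≤ limsup (fun n : ℕ => (((digitComplexity n ξ b : ℝ) / (n : ℝ) : ℝ) : EReal)) atTop) := by
  have key : ∀ μ : ℝ, irrationalityExponent ξ = (μ : EReal) →
      ((1 + (-μ ^ 3 + 2 * μ ^ 2 + μ - 1) / (μ ^ 4 - 2 * μ ^ 3 + 3 * μ ^ 2 - 3 * μ + 1) : ℝ) : EReal)
          ≤ liminf (fun n : ℕ => (((digitComplexity n ξ b : ℝ) / (n : ℝ) : ℝ) : EReal)) atTop ∧
      (((μ + Real.sqrt (4 * (μ - 1) ^ 3 + μ ^ 2)) / (2 * μ * (μ - 1)) : ℝ) : EReal)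
          ≤ limsup (fun n : ℕ => (((digitComplexity n ξ b : ℝ) / (n : ℝ) : ℝ) : EReal)) atTop := by
    intro μ h
    refine ⟨coe_le_liminf_digitComplexity_of_le hb hξ h ?_ ?_,
      (coe_le_liminf_digitComplexity_of_le hb hξ h ?_ ?_).trans (liminf_le_limsup)⟩
    · rintro ν rfl
      exact liminf_slope_le_one
    · rintro ν rfl
      exact liminf_slope_le
    · rintro ν rfl
      exact limsup_slope_le_one
    · rintro ν rfl
      exact limsup_slope_le
  refine ⟨key, fun _ => ?_, fun h => ?_⟩
  · have h1 := one_le_liminf_digitComplexity hb hξ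
    exact ⟨h1, (zero_le_one.trans h1).trans liminf_le_limsup⟩
  · have h2 := key 2 h
    have e1 : (1 + (-2 ^ 3 + 2 * 2 ^ 2 + 2 - 1) / (2 ^ 4 - 2 * 2 ^ 3 + 3 * 2 ^ 2 - 3 * 2 + 1) : ℝ) =
        8 / 7 := by norm_num
    have e2 : ((2 + Real.sqrt (4 * (2 - 1) ^ 3 + 2 ^ 2)) / (2 * 2 * (2 - 1)) : ℝ) =
        (1 + Real.sqrt 2) / 2 := by
      rw [show (4 * (2 - 1) ^ 3 + 2 ^ 2 : ℝ) = 2 ^ 2 * 2 by norm_num,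
        Real.sqrt_mul (by positivity), Real.sqrt_sq (by norm_num)]
      ring
    rwa [e1, e2] at h2
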